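/- Let $\mathcal X,\mathcal Y$ be finite sets, let $P_{XY}$ be a probability mass function on $\mathcal X\times\mathcal Y$, and let $(X_t,Y_t)_{t\in\mathbb Z}$ be independent pairs with common law $P_{XY}$. Let $\mathbf d=\{(\underline d_n,\overline d_n)\}_{n\ge 1}$ be a sequence of pairs of integers with $-n\le\underline d_n\le\overline d_n\le n$, and put $$\Delta_{\mathbf d}=\limsup_{n\to\infty}\frac{\max\{|\overline d_n|,|\underline d_n|\}}{n}.$$ A code of blocklength $n$ consists of positive integers $M_n^{(1)},M_n^{(2)}$, encoders $f_n^{(1)}:\mathcal X^n\to\{1,\dots,M_n^{(1)}\}$ and $f_n^{(2)}:\mathcal Y^n\to\{1,\dots,M_n^{(2)}\}$, and a decoder $\varphi_n:\{1,\dots,M_n^{(1)}\}\times\{1,\dots,M_n^{(2)}\}\to\mathcal X^n\times\mathcal Y^n$. For an integer $d$ write $X^n=(X_1,\dots,X_n)$ and $Y_{(d)}^n=(Y_{1+d},\dots,Y_{n+d})$. A pair $(R_1,R_2)$ of real numbers is achievable for $\mathbf d$ if there is a sequence of codes, one for each $n\ge 1$, such that $\limsup_{n\to\infty}\frac1n\log_2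 M_n^{(i)}\le R_i$ for $i=1,2$ and $$\lim_{n\to\infty}\ \max_{\underline d_n\le d\le\overline d_n}\Pr\left\{\varphi_n\big(f_n^{(1)}(X^n),f_n^{(2)}(Y_{(d)}^n)\big)\ne (X^n,Y_{(d)}^n)\right\}=0 .$$ (The codes may depend on $P_{XY}$ and $\mathbf d$, but not on the actual delay $d$.) Let $\mathcal R_{\mathbf d}(X,Y)$ be the set of all pairs achievable for $\mathbf d$, and let $\mathcal R(X,Y)$ be this set in the case $\underline d_n=\overline d_n=0$ for all $n$, that is, the synchronous Slepian--Wolf rate region. Then $$\mathcal R_{\mathbf d}(X,Y)\ne\mathcal R(X,Y)\quad\Longleftrightarrow\quad \Delta_{\mathbf d}\ne 0\ \text{ and }\ I(X;Y)\ne 0,$$ where $I(X;Y)=\sum_{x,y}P_{XY}(x,y)\log_2\frac{P_{XY}(x,y)}{P_X(x)P_Y(y)}$ is the mutual information. -/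

import Mathlib

open Filter MeasureTheory
open scoped ENNReal Topology

namespace AsyncSW

/-- A code of blocklength `n` for a pair of separately encoded sources with alphabets `α`, `β`:
two encoders with message sets of sizes `M₁`, `M₂`, and a joint decoder. -/
structure Code (α β : Type*) (n : ℕ) where
  M₁ : ℕ
  M₂ : ℕ
  M₁_pos : 0 < M₁
  M₂_pos : 0 < M₂
  enc₁ : (Fin n → α) → Fin M₁
  enc₂ : (Fin n → β) → Fin M₂
  dec : Fin M₁ × Fin M₂ → (Fin n → α) × (Fin n → β)

/-- The rate of the first encoder, in bits per source symbol. -/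
noncomputable def Code.rate₁ {α β : Type*} {n : ℕ} (c : Code α β n) : ℝ :=
  Real.logb 2 c.M₁ / n

/-- The rate of the second encoder, in bits per source symbol. -/
noncomputable def Code.rate₂ {α β : Type*} {n : ℕ} (c : Code α β n) : ℝ :=
  Real.logb 2 c.M₂ / n

/-- For each blocklength `n ≥ 1`, the minimum `lo n` and the maximum `hi n` of the possible
relative delays; the values at `n = 0` play no role. -/
structure DelayBound where
  lo : ℕ → ℤ
  hi : ℕ → ℤ
  neg_le_lo : ∀ n : ℕ, 1 ≤ n → -(n : ℤ) ≤ lo n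
  lo_le_hi : ∀ n : ℕ, 1 ≤ n → lo n ≤ hi n
  hi_le : ∀ n : ℕ, 1 ≤ n → hi n ≤ n

/-- The synchronous case: the only possible delay is `0`. -/
def DelayBound.zero : DelayBound where
  lo := fun _ => 0
  hi := fun _ => 0
  neg_le_lo := fun _ _ => by omega
  lo_le_hi := fun _ _ => le_refl _
  hi_le := fun _ _ => by omega

/-- The asymptotic ratio of the maximum absolute delay to the blocklength. -/
noncomputable def DelayBound.ratio (d : DelayBound) : ℝ :=
  limsup (fun n : ℕ => (max |(d.hi n : ℝ)| |(d.lo n : ℝ)|) / (n : ℝ)) atTop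

/-- The block `X_1, …, X_n` of the first component of a two-sided sequence of pairs. -/
def blockX {α β : Type*} (n : ℕ) (ω : ℤ → α × β) : Fin n → α :=
  fun i => (ω (1 + (i : ℤ))).1

/-- The delayed block `Y_{1+d}, …, Y_{n+d}` of the second component. -/
def blockY {α β : Type*} (n : ℕ) (d : ℤ) (ω : ℤ → α × β) : Fin n → β :=
  fun i => (ω (1 + (i : ℤ) + d)).2

/-- The probability that a code of blocklength `n` fails to reproduce `(X_1^n, Y_{1+d}^{n+d})`,
where the pairs `(X_t, Y_t)`, `t ∈ ℤ`, are independent with common law `P`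
(the alphabets carry the discrete σ-algebra). -/
noncomputable def errorProb {α β : Type*} {n : ℕ} (P : PMF (α × β)) (d : ℤ)
    (c : Code α β n) : ℝ≥0∞ :=
  letI : MeasurableSpace (α × β) := ⊤
  Measure.infinitePi (fun _ : ℤ => P.toMeasure)
    {ω | c.dec (c.enc₁ (blockX n ω), c.enc₂ (blockY n d ω)) ≠ (blockX n ω, blockY n d ω)}

/-- `(R₁, R₂)` is achievable for the set `S` of joint laws and the delay bound `d`: one sequence
of codes has asymptotic rates at most `R₁`, `R₂` and an error probability that vanishes uniformly
over all laws in `S` and all possible delays. -/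
def Achievable {α β : Type*} (S : Set (PMF (α × β))) (d : DelayBound) (R₁ R₂ : ℝ) : Prop :=
  ∃ c : (n : ℕ) → Code α β n,
    limsup (fun n => ((c n).rate₁ : EReal)) atTop ≤ (R₁ : EReal) ∧
    limsup (fun n => ((c n).rate₂ : EReal)) atTop ≤ (R₂ : EReal) ∧
    Tendsto (fun n => ⨆ P ∈ S, ⨆ k ∈ Set.Icc (d.lo n) (d.hi n), errorProb P k (c n))
      atTop (𝓝 0)

/-- The achievable rate region for the set `S` of joint laws and the delay bound `d`. -/
def rateRegion {α β : Type*} (S : Set (PMF (α × β))) (d : DelayBound) : Set (ℝ × ℝ) :=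
  {R | Achievable S d R.1 R.2}

/-- The mutual information (in bits) of the two components of a pair with joint law `P`. -/
noncomputable def mutualInfo {α β : Type*} [Fintype α] [Fintype β] (P : PMF (α × β)) : ℝ :=
  ∑ x : α, ∑ y : β, (P (x, y)).toReal *
    Real.logb 2 ((P (x, y)).toReal /
      ((P.map Prod.fst x).toReal * (P.map Prod.snd y).toReal))

end AsyncSW

/-!
The proof computes both rate regions far enough to compare them.

With relative delay `k`, `|k| ≤ n`, only `n - |k|` positions of the blocks `X_1, …, X_n` and
`Y_{1+k}, …, Y_{n+k}` overlap, so the entropy of the pair of blocks is `n H(X,Y) + |k| I(X;Y)`,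
while the two marginal entropies remain `n H(X)` and `n H(Y)`. Chebyshev's inequality gives the
corresponding equipartition property, uniformly in `k` (`exists_equipartition`,
`exists_sum_not_typicalSet_le`).

*Converse*, for every delay bound. A decoder separates at most `M₁ M₂` pairs of blocks, and at most
`M₁` for each typical `y`; compared with the probabilities of typical pairs this yields
`n H(X,Y) + |k| I(X;Y) ≤ n (R₁ + R₂ + o(1))` and the two conditional analogues, for all admissible
delays `k` (`sum_le_of_injOn`, `Achievable.eventually_le`). Hence every achievable pair lies in the
Slepian–Wolf region, and if delays of linear order occur infinitely often and `I(X;Y) > 0`, then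
`R₁ + R₂ > H(X,Y)` (`entropy_lt_of_achievable`).

*Direct part*, when `|k| I(X;Y) = o(n)` uniformly over the admissible delays. Random binning works
for all delays at once: the decoder looks for a pair that is typical for some admissible delay, and
the union over at most `2 n + 1` delays costs only a polynomial factor
(`exists_code_of_family`, `eventually_exists_code`).

So if the ratio or `I(X;Y)` vanishes, the region is the Slepian–Wolf region
(`rateRegion_eq_slepianWolfRegion`), and in particular so is the synchronous region. Otherwise the
corner point `(H(X|Y), H(Y))`, whose sum rate is `H(X,Y)`, belongs to the synchronous region only.
-/

namespace AsyncSW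

open ProbabilityTheory

/-! ### Coordinates of an i.i.d. sequence -/

/-- Chebyshev's inequality for a finite sum of uniformly bounded functions of distinct coordinates
of an i.i.d. sequence. -/
lemma chebyshev_sum_eval {Z : Type*} [MeasurableSpace Z] [DiscreteMeasurableSpace Z]
    (ν : Measure Z) [IsProbabilityMeasure ν] (F : ℤ → Z → ℝ) {K : ℝ} (hK : ∀ t z, |F t z| ≤ K)
    (s : Finset ℤ) {c : ℝ} (hc : 0 < c) :
    (Measure.infinitePi fun _ : ℤ => ν).real
        {ω | c ≤ |∑ t ∈ s, F t (ω t) - ∑ t ∈ s, ∫ z, F t z ∂ν|} ≤ s.card * K ^ 2 / c ^ 2 := by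
  set μ := Measure.infinitePi fun _ : ℤ => ν
  have hmeas : ∀ t, Measurable (F t) := fun t => .of_discrete
  have hmF : ∀ t, Measurable fun ω : ℤ → Z => F t (ω t) :=
    fun t => (hmeas t).comp (measurable_pi_apply t)
  have hL : ∀ t, MemLp (fun ω : ℤ → Z => F t (ω t)) 2 μ := fun t =>
    MemLp.of_bound (hmF t).aestronglyMeasurable K (.of_forall fun ω => hK t (ω t))
  have hsum : MemLp (∑ t ∈ s, fun ω : ℤ → Z => F t (ω t)) 2 μ := memLp_finsetSum' s fun t _ => hL t
  have hint : ∀ t, ∫ ω, F t (ω t) ∂μ = ∫ z, F t z ∂ν := fun t => by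
    have h := measurePreserving_eval_infinitePi (fun _ : ℤ => ν) t
    rw [← h.map_eq, integral_map (measurable_pi_apply t).aemeasurable
      (hmeas t).aestronglyMeasurable]
  have hE : ∫ ω, (∑ t ∈ s, fun ω : ℤ → Z => F t (ω t)) ω ∂μ = ∑ t ∈ s, ∫ z, F t z ∂ν := by
    simp only [Finset.sum_apply]
    rw [integral_finsetSum s fun t _ => (hL t).integrable (by norm_num)]
    exact Finset.sum_congr rfl fun t _ => hint t
  have hvar : Var[∑ t ∈ s, fun ω : ℤ → Z => F t (ω t); μ] ≤ s.card * K ^ 2 := by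
    have hind : iIndepFun (fun (t : ℤ) (ω : ℤ → Z) => F t (ω t)) μ :=
      iIndepFun_infinitePi (P := fun _ : ℤ => ν) (X := F) hmeas
    rw [IndepFun.variance_sum (fun t _ => hL t) (fun i _ j _ hij => hind.indepFun hij)]
    have hv : ∀ t, Var[fun ω : ℤ → Z => F t (ω t); μ] ≤ K ^ 2 := fun t =>
      (variance_le_sq_of_bounded (a := -K) (b := K) (X := fun ω : ℤ → Z => F t (ω t))
        (.of_forall fun ω => abs_le.1 (hK t (ω t))) (hmF t).aemeasurable).trans
        (le_of_eq (by ring))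
    calc ∑ t ∈ s, Var[fun ω : ℤ → Z => F t (ω t); μ] ≤ ∑ t ∈ s, K ^ 2 :=
          Finset.sum_le_sum fun t _ => hv t
      _ = s.card * K ^ 2 := by simp
  have h := meas_ge_le_variance_div_sq hsum hc
  rw [hE] at h
  simp only [Finset.sum_apply] at h
  rw [measureReal_def]
  refine (ENNReal.toReal_le_of_le_ofReal (div_nonneg (variance_nonneg _ _) (sq_nonneg _))
    h).trans ?_
  gcongr

variable {α β : Type*}

/-- The probability that a pair with law `P` agrees with `z` in its first component, if `a`, and
in its second component, if `b`: according to which of `a` and `b` hold, this is `P z`, one of the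
two marginal probabilities, or `1`. -/
noncomputable def agreeProb (P : PMF (α × β)) (a b : Prop) (z : α × β) : ℝ :=
  (P.toOuterMeasure {w | (a → w.1 = z.1) ∧ (b → w.2 = z.2)}).toReal

lemma agreeProb_eq_measureReal [MeasurableSpace (α × β)] [DiscreteMeasurableSpace (α × β)]
    (P : PMF (α × β)) (a b : Prop) (z : α × β) :
    agreeProb P a b z = P.toMeasure.real {w | (a → w.1 = z.1) ∧ (b → w.2 = z.2)} := by
  rw [agreeProb, measureReal_def, PMF.toMeasure_apply_eq_toOuterMeasure_apply _ .of_discrete]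

lemma agreeProb_pos (P : PMF (α × β)) (a b : Prop) {z : α × β} (hz : P z ≠ 0) :
    0 < agreeProb P a b z := by
  let _ : MeasurableSpace (α × β) := ⊤
  have : DiscreteMeasurableSpace (α × β) := ⟨fun _ => trivial⟩
  rw [agreeProb_eq_measureReal]
  have h : P.toMeasure {z} ≤ P.toMeasure {w | (a → w.1 = z.1) ∧ (b → w.2 = z.2)} :=
    measure_mono (by rintro _ rfl; simp)
  rw [PMF.toMeasure_apply_singleton _ _ .of_discrete] at h
  exact ENNReal.toReal_pos ((pos_iff_ne_zero.2 hz).trans_le h).ne' (measure_ne_top _ _)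

lemma agreeProb_true_true (P : PMF (α × β)) (z : α × β) :
    agreeProb P True True z = (P z).toReal := by
  have : {w : α × β | (True → w.1 = z.1) ∧ (True → w.2 = z.2)} = {z} := by
    ext w; simp [Prod.ext_iff]
  rw [agreeProb, this, PMF.toOuterMeasure_apply_singleton]

lemma agreeProb_true_false (P : PMF (α × β)) (z : α × β) :
    agreeProb P True False z = (P.map Prod.fst z.1).toReal := by
  rw [agreeProb, ← PMF.toOuterMeasure_apply_singleton, PMF.toOuterMeasure_map_apply]
  congr 2
  ext w; simp

lemma agreeProb_false_true (P : PMF (α × β)) (z : α × β) :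
    agreeProb P False True z = (P.map Prod.snd z.2).toReal := by
  rw [agreeProb, ← PMF.toOuterMeasure_apply_singleton, PMF.toOuterMeasure_map_apply]
  congr 2
  ext w; simp

lemma sum_toReal_eq_one {γ : Type*} [Fintype γ] (p : PMF γ) : ∑ z, (p z).toReal = 1 := by
  rw [← ENNReal.toReal_sum fun z _ => p.apply_ne_top z, ← tsum_fintype (L := .unconditional _),
    p.tsum_coe, ENNReal.toReal_one]

/-- The entropy, in bits, of those components of a pair with law `P` that are selected by `a` and
`b`: `H(X,Y)`, `H(X)`, `H(Y)` or `0`. -/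
noncomputable def agreeEntropy [Fintype α] [Fintype β] (P : PMF (α × β)) (a b : Prop) : ℝ :=
  ∑ z, (P z).toReal * -Real.logb 2 (agreeProb P a b z)

lemma mutualInfo_eq [Fintype α] [Fintype β] (P : PMF (α × β)) :
    mutualInfo P = agreeEntropy P True False + agreeEntropy P False True
      - agreeEntropy P True True := by
  simp only [mutualInfo, agreeEntropy, ← Finset.sum_add_distrib, ← Finset.sum_sub_distrib,
    ← Fintype.sum_prod_type']
  refine Finset.sum_congr rfl fun z _ => ?_
  by_cases hz : P z = 0
  · simp [hz]
  · have h1 := agreeProb_pos P True False hz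
    have h2 := agreeProb_pos P False True hz
    have h3 := agreeProb_pos P True True hz
    rw [agreeProb_true_false] at h1 ⊢
    rw [agreeProb_false_true] at h2 ⊢
    rw [agreeProb_true_true] at h3 ⊢
    rw [Real.logb_div h3.ne' (by positivity), Real.logb_mul h1.ne' h2.ne']
    ring

lemma agreeEntropy_false_false [Fintype α] [Fintype β] (P : PMF (α × β)) :
    agreeEntropy P False False = 0 := by
  let _ : MeasurableSpace (α × β) := ⊤
  have : DiscreteMeasurableSpace (α × β) := ⟨fun _ => trivial⟩
  simp [agreeEntropy, agreeProb_eq_measureReal]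

lemma mutualInfo_nonneg [Fintype α] [Fintype β] (P : PMF (α × β)) : 0 ≤ mutualInfo P := by
  -- Gibbs' inequality, termwise: `p * log (p / q) ≥ p - q`.
  have hlog : 0 < Real.log 2 := Real.log_pos (by norm_num)
  have key : ∀ x y, ((P (x, y)).toReal - (P.map Prod.fst x).toReal * (P.map Prod.snd y).toReal)
      / Real.log 2 ≤ (P (x, y)).toReal * Real.logb 2 ((P (x, y)).toReal /
      ((P.map Prod.fst x).toReal * (P.map Prod.snd y).toReal)) := by
    intro x y
    rw [Real.logb, ← mul_div_assoc]
    gcongr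
    by_cases hz : P (x, y) = 0
    · simp only [hz, ENNReal.toReal_zero, zero_sub, zero_mul, Left.neg_nonpos_iff]
      positivity
    · have h1 := agreeProb_pos P True False hz
      have h2 := agreeProb_pos P False True hz
      have h3 := agreeProb_pos P True True hz
      rw [agreeProb_true_false] at h1
      rw [agreeProb_false_true] at h2
      rw [agreeProb_true_true] at h3
      have h := mul_le_mul_of_nonneg_left (Real.one_sub_inv_le_log_of_pos
        (div_pos h3 (mul_pos h1 h2))) h3.le
      refine le_trans (le_of_eq ?_) h
      simp only at h1 h2
      field_simp
  have hsum : ∑ x, ∑ y, ((P (x, y)).toReal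
      - (P.map Prod.fst x).toReal * (P.map Prod.snd y).toReal) / Real.log 2 = 0 := by
    simp only [← Finset.sum_div, Finset.sum_sub_distrib, ← Finset.mul_sum, sum_toReal_eq_one,
      ← Fintype.sum_prod_type', Prod.mk.eta, mul_one, sub_self, zero_div]
  rw [mutualInfo, ← hsum]
  exact Finset.sum_le_sum fun x _ => Finset.sum_le_sum fun y _ => key x y

/-- The sequences whose first components agree with those of `ω₀` at the times in `A` and whose
second components agree with those of `ω₀` at the times in `B`. -/
def agreeSet (A B : Finset ℤ) (ω₀ : ℤ → α × β) : Set (ℤ → α × β) :=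
  {ω | (∀ t ∈ A, (ω t).1 = (ω₀ t).1) ∧ ∀ t ∈ B, (ω t).2 = (ω₀ t).2}

lemma measureReal_agreeSet [MeasurableSpace (α × β)] [DiscreteMeasurableSpace (α × β)]
    (P : PMF (α × β)) (A B : Finset ℤ) (ω₀ : ℤ → α × β) :
    (Measure.infinitePi fun _ : ℤ => P.toMeasure).real (agreeSet A B ω₀)
      = ∏ t ∈ A ∪ B, agreeProb P (t ∈ A) (t ∈ B) (ω₀ t) := by
  have : agreeSet A B ω₀ = ((A ∪ B : Finset ℤ) : Set ℤ).pi
      fun t => {w | (t ∈ A → w.1 = (ω₀ t).1) ∧ (t ∈ B → w.2 = (ω₀ t).2)} := by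
    ext ω
    simp only [agreeSet, Set.mem_ofPred_eq, Set.mem_pi, Finset.coe_union, Set.mem_union,
      Finset.mem_coe]
    grind
  simp only [this, measureReal_def, agreeProb_eq_measureReal]
  rw [Measure.infinitePi_pi _ fun _ _ => .of_discrete, ENNReal.toReal_prod]

lemma sum_agreeEntropy [Fintype α] [Fintype β] (P : PMF (α × β)) (A B : Finset ℤ) :
    ∑ t ∈ A ∪ B, agreeEntropy P (t ∈ A) (t ∈ B)
      = A.card * agreeEntropy P True False + B.card * agreeEntropy P False True
        - (A ∩ B).card * mutualInfo P := by
  have h : ∀ t ∈ A ∪ B, agreeEntropy P (t ∈ A) (t ∈ B)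
      = (if t ∈ A then agreeEntropy P True False else 0)
        + (if t ∈ B then agreeEntropy P False True else 0)
        - (if t ∈ A ∩ B then mutualInfo P else 0) := by
    intro t _
    by_cases hA : t ∈ A <;> by_cases hB : t ∈ B <;>
      simp [hA, hB, mutualInfo_eq, agreeEntropy_false_false]
  rw [Finset.sum_congr rfl h]
  simp only [Finset.sum_sub_distrib, Finset.sum_add_distrib, ← Finset.sum_filter,
    Finset.sum_const, nsmul_eq_mul, Finset.filter_mem_eq_inter,
    Finset.inter_eq_right.2 (Finset.subset_union_left : A ⊆ A ∪ B),
    Finset.inter_eq_right.2 (Finset.subset_union_right : B ⊆ A ∪ B),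
    Finset.inter_eq_right.2 (Finset.inter_subset_union : A ∩ B ⊆ A ∪ B)]

/-- The asymptotic equipartition property: the probability of the observed components
`(X_t)_{t ∈ A}`, `(Y_t)_{t ∈ B}` is close to `2 ^ (-h)`, where `h` is their entropy. Times in
`A ∩ B` contribute `H(X,Y) = H(X) + H(Y) - I(X;Y)` to `h`, the others `H(X)` or `H(Y)`. -/
lemma exists_equipartition [MeasurableSpace (α × β)] [DiscreteMeasurableSpace (α × β)]
    [Fintype α] [Fintype β] (P : PMF (α × β)) :
    ∃ K : ℝ, 0 ≤ K ∧ ∀ (A B : Finset ℤ) (h c : ℝ), 0 < c →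
      h = A.card * agreeEntropy P True False + B.card * agreeEntropy P False True
        - (A ∩ B).card * mutualInfo P →
      (Measure.infinitePi fun _ : ℤ => P.toMeasure).real
        {ω | (Measure.infinitePi fun _ : ℤ => P.toMeasure).real (agreeSet A B ω)
          ∉ Set.Icc ((2 : ℝ) ^ (-(h + c))) ((2 : ℝ) ^ (-(h - c)))}
        ≤ (A.card + B.card) * K / c ^ 2 := by
  obtain ⟨K, hK⟩ : ∃ K : ℝ, ∀ u : (α × β) × Prop × Prop,
      |(-Real.logb 2 (agreeProb P u.2.1 u.2.2 u.1))| ≤ K :=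
    (Set.finite_range fun u : (α × β) × Prop × Prop =>
      |(-Real.logb 2 (agreeProb P u.2.1 u.2.2 u.1))|).bddAbove.imp
      fun K h u => h ⟨u, rfl⟩
  refine ⟨K ^ 2, sq_nonneg K, fun A B h c hc hh => ?_⟩
  set μ := Measure.infinitePi fun _ : ℤ => P.toMeasure
  set F : ℤ → α × β → ℝ := fun t z => -Real.logb 2 (agreeProb P (t ∈ A) (t ∈ B) z) with hF
  have hcheb := chebyshev_sum_eval P.toMeasure F (K := K)
    (fun t z => hK (z, t ∈ A, t ∈ B)) (A ∪ B) hc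
  have hmean : ∑ t ∈ A ∪ B, ∫ z, F t z ∂P.toMeasure = h := by
    rw [hh, ← sum_agreeEntropy]
    refine Finset.sum_congr rfl fun t _ => ?_
    rw [PMF.integral_eq_sum]
    rfl
  rw [hmean] at hcheb
  have hae : ∀ᵐ ω ∂μ, ∀ t, P (ω t) ≠ 0 := by
    rw [ae_all_iff]
    intro t
    have h0 : ∀ᵐ z ∂P.toMeasure, P z ≠ 0 := by
      rw [ae_iff, PMF.toMeasure_apply_eq_zero_iff _ .of_discrete, Set.disjoint_left]
      intro z hz
      simpa [PMF.mem_support_iff] using hz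
    exact (measurePreserving_eval_infinitePi (fun _ : ℤ => P.toMeasure) t).quasiMeasurePreserving.ae
      h0
  have hle : μ.real {ω | μ.real (agreeSet A B ω)
      ∉ Set.Icc ((2 : ℝ) ^ (-(h + c))) ((2 : ℝ) ^ (-(h - c)))}
      ≤ μ.real {ω | c ≤ |∑ t ∈ A ∪ B, F t (ω t) - h|} := by
    refine ENNReal.toReal_mono (measure_ne_top _ _) (measure_mono_ae ?_)
    filter_upwards [hae] with ω hω hmem
    change c ≤ |∑ t ∈ A ∪ B, F t (ω t) - h|
    by_contra! hlt
    apply hmem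
    have hpos : ∀ t ∈ A ∪ B, agreeProb P (t ∈ A) (t ∈ B) (ω t) ≠ 0 :=
      fun t _ => (agreeProb_pos P _ _ (hω t)).ne'
    have hprod : 0 < ∏ t ∈ A ∪ B, agreeProb P (t ∈ A) (t ∈ B) (ω t) :=
      Finset.prod_pos fun t _ => agreeProb_pos P _ _ (hω t)
    have hlog : ∑ t ∈ A ∪ B, F t (ω t)
        = -Real.logb 2 (∏ t ∈ A ∪ B, agreeProb P (t ∈ A) (t ∈ B) (ω t)) := by
      rw [Real.logb_prod _ _ hpos, ← Finset.sum_neg_distrib]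
    rw [hlog, abs_lt] at hlt
    rw [measureReal_agreeSet, ← Real.rpow_logb two_pos (by norm_num) hprod, Set.mem_Icc,
      Real.rpow_le_rpow_left_iff one_lt_two, Real.rpow_le_rpow_left_iff one_lt_two]
    constructor <;> linarith
  refine hle.trans (hcheb.trans ?_)
  gcongr
  exact_mod_cast Finset.card_union_le A B

end AsyncSW

namespace AsyncSW

/-! ### One-shot bounds for a single pair of blocks -/

section OneShot

variable {X Y : Type*} [Fintype X] [Fintype Y]

open Classical in
/-- The pairs whose joint and marginal probabilities under `Q` are all within a factor `2 ^ c` of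
`2 ^ (-h)`, `2 ^ (-h₁)` and `2 ^ (-h₂)`. -/
noncomputable def typicalSet (Q : X × Y → ℝ) (h h₁ h₂ c : ℝ) : Finset (X × Y) :=
  {w | Q w ∈ Set.Icc ((2 : ℝ) ^ (-(h + c))) ((2 : ℝ) ^ (-(h - c))) ∧
    ∑ y, Q (w.1, y) ∈ Set.Icc ((2 : ℝ) ^ (-(h₁ + c))) ((2 : ℝ) ^ (-(h₁ - c))) ∧
    ∑ x, Q (x, w.2) ∈ Set.Icc ((2 : ℝ) ^ (-(h₂ + c))) ((2 : ℝ) ^ (-(h₂ - c)))}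

variable {Q : X × Y → ℝ} {h h₁ h₂ c : ℝ}

lemma mem_typicalSet {w : X × Y} : w ∈ typicalSet Q h h₁ h₂ c ↔
    Q w ∈ Set.Icc ((2 : ℝ) ^ (-(h + c))) ((2 : ℝ) ^ (-(h - c))) ∧
    ∑ y, Q (w.1, y) ∈ Set.Icc ((2 : ℝ) ^ (-(h₁ + c))) ((2 : ℝ) ^ (-(h₁ - c))) ∧
    ∑ x, Q (x, w.2) ∈ Set.Icc ((2 : ℝ) ^ (-(h₂ + c))) ((2 : ℝ) ^ (-(h₂ - c))) := by
  simp [typicalSet]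

lemma card_le_rpow_of_le {ι : Type*} {S : Finset ι} {f : ι → ℝ} {a b : ℝ}
    (hf : ∀ i ∈ S, (2 : ℝ) ^ (-a) ≤ f i) (hS : ∑ i ∈ S, f i ≤ (2 : ℝ) ^ b) :
    (S.card : ℝ) ≤ (2 : ℝ) ^ (a + b) := by
  have h1 := (Finset.card_nsmul_le_sum S f _ hf).trans hS
  rw [nsmul_eq_mul, Real.rpow_neg zero_le_two, ← div_eq_mul_inv, div_le_iff₀ (by positivity),
    ← Real.rpow_add two_pos] at h1
  rwa [add_comm a b]

lemma card_typicalSet_le (hQ : ∀ w, 0 ≤ Q w) (hQ1 : ∑ w, Q w ≤ 1) :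
    ((typicalSet Q h h₁ h₂ c).card : ℝ) ≤ (2 : ℝ) ^ (h + c) := by
  have := card_le_rpow_of_le (S := typicalSet Q h h₁ h₂ c) (f := Q) (a := h + c) (b := 0)
    (fun w hw => (mem_typicalSet.1 hw).1.1) (by
      rw [Real.rpow_zero]
      exact (Finset.sum_le_univ_sum_of_nonneg hQ).trans hQ1)
  rwa [add_zero] at this

lemma card_typicalSet_snd_eq_le [DecidableEq Y] (hQ : ∀ w, 0 ≤ Q w) (y : Y) :
    (((typicalSet Q h h₁ h₂ c).filter fun w => w.2 = y).card : ℝ) ≤ (2 : ℝ) ^ (h - h₂ + 2 * c) := by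
  rcases ((typicalSet Q h h₁ h₂ c).filter fun w => w.2 = y).eq_empty_or_nonempty with he | ⟨w₀, hw₀⟩
  · rw [he]
    simp only [Finset.card_empty, Nat.cast_zero]
    positivity
  · rw [Finset.mem_filter] at hw₀
    have hy := (mem_typicalSet.1 hw₀.1).2.2.2
    rw [hw₀.2] at hy
    have := card_le_rpow_of_le (S := (typicalSet Q h h₁ h₂ c).filter fun w => w.2 = y) (f := Q)
      (a := h + c) (b := -(h₂ - c))
      (fun w hw => (mem_typicalSet.1 (Finset.mem_filter.1 hw).1).1.1) (by
        refine le_trans ?_ hy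
        calc _ ≤ ∑ w with w.2 = y, Q w :=
              Finset.sum_le_sum_of_subset_of_nonneg
                (Finset.filter_subset_filter _ (Finset.subset_univ _)) fun w _ _ => hQ w
          _ = ∑ x, Q (x, y) := by
              rw [Finset.sum_filter, Fintype.sum_prod_type]
              simp)
    convert this using 2
    ring

lemma card_typicalSet_fst_eq_le [DecidableEq X] (hQ : ∀ w, 0 ≤ Q w) (x : X) :
    (((typicalSet Q h h₁ h₂ c).filter fun w => w.1 = x).card : ℝ) ≤ (2 : ℝ) ^ (h - h₁ + 2 * c) := by
  rcases ((typicalSet Q h h₁ h₂ c).filter fun w => w.1 = x).eq_empty_or_nonempty with he | ⟨w₀, hw₀⟩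
  · rw [he]
    simp only [Finset.card_empty, Nat.cast_zero]
    positivity
  · rw [Finset.mem_filter] at hw₀
    have hx := (mem_typicalSet.1 hw₀.1).2.1.2
    rw [hw₀.2] at hx
    have := card_le_rpow_of_le (S := (typicalSet Q h h₁ h₂ c).filter fun w => w.1 = x) (f := Q)
      (a := h + c) (b := -(h₁ - c))
      (fun w hw => (mem_typicalSet.1 (Finset.mem_filter.1 hw).1).1.1) (by
        refine le_trans ?_ hx
        calc _ ≤ ∑ w with w.1 = x, Q w :=
              Finset.sum_le_sum_of_subset_of_nonneg
                (Finset.filter_subset_filter _ (Finset.subset_univ _)) fun w _ _ => hQ w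
          _ = ∑ y, Q (x, y) := by
              rw [Finset.sum_filter, Fintype.sum_prod_type_right]
              simp)
    convert this using 2
    ring

lemma card_image_snd_typicalSet_le [DecidableEq Y] (hQ : ∀ w, 0 ≤ Q w) (hQ1 : ∑ w, Q w ≤ 1) :
    (((typicalSet Q h h₁ h₂ c).image Prod.snd).card : ℝ) ≤ (2 : ℝ) ^ (h₂ + c) := by
  have := card_le_rpow_of_le (S := (typicalSet Q h h₁ h₂ c).image Prod.snd)
    (f := fun y => ∑ x, Q (x, y)) (a := h₂ + c) (b := 0)
    (fun y hy => by
      obtain ⟨w, hw, rfl⟩ := Finset.mem_image.1 hy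
      exact (mem_typicalSet.1 hw).2.2.1) (by
      rw [Real.rpow_zero]
      refine (Finset.sum_le_univ_sum_of_nonneg fun y => Finset.sum_nonneg fun x _ => hQ _).trans ?_
      rwa [← Fintype.sum_prod_type_right'])
  rwa [add_zero] at this

lemma card_image_fst_typicalSet_le [DecidableEq X] (hQ : ∀ w, 0 ≤ Q w) (hQ1 : ∑ w, Q w ≤ 1) :
    (((typicalSet Q h h₁ h₂ c).image Prod.fst).card : ℝ) ≤ (2 : ℝ) ^ (h₁ + c) := by
  have := card_le_rpow_of_le (S := (typicalSet Q h h₁ h₂ c).image Prod.fst)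
    (f := fun x => ∑ y, Q (x, y)) (a := h₁ + c) (b := 0)
    (fun x hx => by
      obtain ⟨w, hw, rfl⟩ := Finset.mem_image.1 hx
      exact (mem_typicalSet.1 hw).2.1.1) (by
      rw [Real.rpow_zero]
      refine (Finset.sum_le_univ_sum_of_nonneg fun x => Finset.sum_nonneg fun y _ => hQ _).trans ?_
      rwa [← Fintype.sum_prod_type'])
  rwa [add_zero] at this

/-- The one-shot converse: a set `S` on which the pair of codewords determines the source pair
contains at most `M₁ M₂` pairs, and, among the typical ones, at most `M₁` for each typical `y` and
at most `M₂` for each typical `x`. -/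
lemma sum_le_of_injOn [DecidableEq X] [DecidableEq Y] (hQ : ∀ w, 0 ≤ Q w)
    (hQ1 : ∑ w, Q w ≤ 1) {M₁ M₂ : ℕ} {f₁ : X → Fin M₁} {f₂ : Y → Fin M₂} {S : Finset (X × Y)}
    (hS : Set.InjOn (fun w : X × Y => (f₁ w.1, f₂ w.2)) S) :
    ∑ w ∈ S, Q w ≤ ∑ w with w ∉ typicalSet Q h h₁ h₂ c, Q w + M₁ * M₂ * (2 : ℝ) ^ (-(h - c)) ∧
    ∑ w ∈ S, Q w ≤ ∑ w with w ∉ typicalSet Q h h₁ h₂ c, Q w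
      + M₁ * (2 : ℝ) ^ (-(h - h₂ - 2 * c)) ∧
    ∑ w ∈ S, Q w ≤ ∑ w with w ∉ typicalSet Q h h₁ h₂ c, Q w
      + M₂ * (2 : ℝ) ^ (-(h - h₁ - 2 * c)) := by
  set T := typicalSet Q h h₁ h₂ c with hT
  have main : ∑ w ∈ S, Q w ≤ ∑ w with w ∉ T, Q w + (S ∩ T).card * (2 : ℝ) ^ (-(h - c)) := by
    have h1 : ∑ w ∈ S ∩ T, Q w ≤ (S ∩ T).card * (2 : ℝ) ^ (-(h - c)) := by
      rw [← nsmul_eq_mul]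
      exact Finset.sum_le_card_nsmul _ _ _ fun w hw =>
        (mem_typicalSet.1 (Finset.mem_inter.1 hw).2).1.2
    have h2 : ∑ w ∈ S \ T, Q w ≤ ∑ w with w ∉ T, Q w :=
      Finset.sum_le_sum_of_subset_of_nonneg (fun w hw => by
        simpa using (Finset.mem_sdiff.1 hw).2) fun w _ _ => hQ w
    rw [← Finset.sum_inter_add_sum_sdiff S T]
    linarith
  have hST : ∀ w ∈ S ∩ T, w ∈ S ∧ w ∈ T := fun w hw => Finset.mem_inter.1 hw
  have c0 : (S ∩ T).card ≤ M₁ * M₂ := by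
    have := Finset.card_le_card_of_injOn (s := S ∩ T)
      (t := (Finset.univ : Finset (Fin M₁ × Fin M₂)))
      (fun w : X × Y => (f₁ w.1, f₂ w.2)) (fun _ _ => by simp)
      (hS.mono fun w hw => (hST w hw).1)
    simpa using this
  have c1 : (S ∩ T).card ≤ M₁ * (T.image Prod.snd).card := by
    have := Finset.card_le_card_of_injOn (s := S ∩ T)
      (t := (Finset.univ : Finset (Fin M₁)) ×ˢ T.image Prod.snd)
      (fun w : X × Y => (f₁ w.1, w.2)) (fun w hw => by
        simpa using ⟨w.1, (hST w hw).2⟩) (fun w hw w' hw' he => by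
        simp only [Prod.mk.injEq] at he
        exact hS (hST w hw).1 (hST w' hw').1 (by simp [he.1, he.2]))
    simpa using this
  have c2 : (S ∩ T).card ≤ M₂ * (T.image Prod.fst).card := by
    have := Finset.card_le_card_of_injOn (s := S ∩ T)
      (t := (Finset.univ : Finset (Fin M₂)) ×ˢ T.image Prod.fst)
      (fun w : X × Y => (f₂ w.2, w.1)) (fun w hw => by
        simpa using ⟨w.2, (hST w hw).2⟩) (fun w hw w' hw' he => by
        simp only [Prod.mk.injEq] at he
        exact hS (hST w hw).1 (hST w' hw').1 (by simp [he.1, he.2]))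
    simpa using this
  refine ⟨main.trans ?_, main.trans ?_, main.trans ?_⟩
  · gcongr
    exact_mod_cast c0
  · rw [show -(h - h₂ - 2 * c) = (h₂ + c) + -(h - c) by ring, Real.rpow_add two_pos, ← mul_assoc]
    gcongr
    calc ((S ∩ T).card : ℝ) ≤ M₁ * (T.image Prod.snd).card := by exact_mod_cast c1
      _ ≤ _ := by gcongr; exact card_image_snd_typicalSet_le hQ hQ1
  · rw [show -(h - h₁ - 2 * c) = (h₁ + c) + -(h - c) by ring, Real.rpow_add two_pos, ← mul_assoc]
    gcongr
    calc ((S ∩ T).card : ℝ) ≤ M₂ * (T.image Prod.fst).card := by exact_mod_cast c2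
      _ ≤ _ := by gcongr; exact card_image_fst_typicalSet_le hQ hQ1

/-! ### Random binning -/

/-- Two distinct points collide under at most a fraction `1 / M` of all maps to `Fin M`: resetting
the value at `x` turns each such map into `M` different maps. -/
lemma card_collision_le [DecidableEq X] {M : ℕ} (hM : 0 < M) {x x' : X} (hx : x' ≠ x) :
    ((Finset.univ.filter fun f : X → Fin M => f x' = f x).card : ℝ)
      ≤ Fintype.card (X → Fin M) / M := by
  rw [le_div_iff₀ (by exact_mod_cast hM)]
  have := Finset.card_le_card_of_injOn
    (s := (Finset.univ.filter fun f : X → Fin M => f x' = f x) ×ˢ (Finset.univ : Finset (Fin M)))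
    (t := (Finset.univ : Finset (X → Fin M)))
    (fun p => Function.update p.1 x p.2) (fun _ _ => by simp) (by
      rintro ⟨f, m⟩ hf ⟨g, m'⟩ hg he
      simp only [Finset.coe_product, Set.mem_prod, Finset.mem_coe, Finset.mem_filter,
        Finset.mem_univ, true_and, and_true] at hf hg
      simp only at he
      have hm : m = m' := by simpa using congrFun he x
      have hne : ∀ z, z ≠ x → f z = g z := fun z hz => by simpa [hz] using congrFun he z
      refine Prod.ext (funext fun z => ?_) hm
      by_cases hz : z = x
      · rw [hz]
        exact hf.symm.trans ((hne x' hx).trans hg)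
      · exact hne z hz)
  rw [Finset.card_product, Finset.card_univ, Finset.card_univ, Fintype.card_fin] at this
  exact_mod_cast this

/-- Some pair of maps has at most the average probability, over all pairs of maps, that the source
pair collides with another element of `T`. -/
lemma exists_binning [DecidableEq X] [DecidableEq Y] (T : Finset (X × Y))
    (hQ : ∀ w, 0 ≤ Q w) {N N₁ N₂ : ℝ} {M₁ M₂ : ℕ}
    (hM₁ : 0 < M₁) (hM₂ : 0 < M₂) (hN : (T.card : ℝ) ≤ N)
    (hN₁ : ∀ y, ((T.filter fun w => w.2 = y).card : ℝ) ≤ N₁)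
    (hN₂ : ∀ x, ((T.filter fun w => w.1 = x).card : ℝ) ≤ N₂) :
    ∃ (f₁ : X → Fin M₁) (f₂ : Y → Fin M₂),
      ∑ w with ∃ w' ∈ T, w' ≠ w ∧ f₁ w'.1 = f₁ w.1 ∧ f₂ w'.2 = f₂ w.2, Q w
        ≤ (∑ w, Q w) * (N₁ / M₁ + N₂ / M₂ + N / (M₁ * M₂)) := by
  have : Nonempty (Fin M₁) := ⟨⟨0, hM₁⟩⟩
  have : Nonempty (Fin M₂) := ⟨⟨0, hM₂⟩⟩
  set F₁ : ℝ := ((Fintype.card (X → Fin M₁) : ℕ) : ℝ) with hF₁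
  set F₂ : ℝ := ((Fintype.card (Y → Fin M₂) : ℕ) : ℝ) with hF₂
  set D := (Finset.univ : Finset ((X → Fin M₁) × (Y → Fin M₂)))
  let col : X × Y → X × Y → Finset ((X → Fin M₁) × (Y → Fin M₂)) := fun w w' =>
    D.filter fun f => f.1 w'.1 = f.1 w.1 ∧ f.2 w'.2 = f.2 w.2
  have hcol : ∀ w w', w' ≠ w → ((col w w').card : ℝ) ≤ F₁ * F₂ *
      ((if w'.2 = w.2 then (1 / M₁ : ℝ) else 0)
      + (if w'.1 = w.1 then (1 / M₂ : ℝ) else 0) + 1 / (M₁ * M₂) : ℝ) := by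
    intro w w' hne
    have hprod : ((col w w').card : ℝ) =
        (Finset.univ.filter fun f : X → Fin M₁ => f w'.1 = f w.1).card
        * (Finset.univ.filter fun f : Y → Fin M₂ => f w'.2 = f w.2).card := by
      rw [← Nat.cast_mul, ← Finset.card_product, ← Finset.filter_product]
      rfl
    have ht₁ : ((Finset.univ.filter fun f : X → Fin M₁ => f w'.1 = f w.1).card : ℝ) ≤ F₁ := by
      exact Nat.cast_le.2 (Finset.card_le_univ _)
    have ht₂ : ((Finset.univ.filter fun f : Y → Fin M₂ => f w'.2 = f w.2).card : ℝ) ≤ F₂ := by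
      exact Nat.cast_le.2 (Finset.card_le_univ _)
    rw [hprod]
    by_cases h1 : w'.1 = w.1
    · have h2 : w'.2 ≠ w.2 := fun h2 => hne (Prod.ext h1 h2)
      calc _ ≤ F₁ * (F₂ / M₂) := by
            gcongr
            exact card_collision_le hM₂ h2
        _ = F₁ * F₂ * (1 / M₂) := by ring
        _ ≤ _ := by
            gcongr
            rw [if_neg h2, if_pos h1, zero_add]
            exact le_add_of_nonneg_right (by positivity)
    · by_cases h2 : w'.2 = w.2
      · calc _ ≤ (F₁ / M₁) * F₂ := by
              gcongr
              exact card_collision_le hM₁ h1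
          _ = F₁ * F₂ * (1 / M₁) := by ring
          _ ≤ _ := by
              gcongr
              rw [if_neg h1, if_pos h2, add_zero]
              exact le_add_of_nonneg_right (by positivity)
      · calc _ ≤ (F₁ / M₁) * (F₂ / M₂) := by
              gcongr
              · exact card_collision_le hM₁ h1
              · exact card_collision_le hM₂ h2
          _ = F₁ * F₂ * (1 / (M₁ * M₂)) := by ring
          _ ≤ _ := by
              rw [if_neg h1, if_neg h2, add_zero, zero_add]
  have hw : ∀ w, ((D.filter fun f =>
      ∃ w' ∈ T, w' ≠ w ∧ f.1 w'.1 = f.1 w.1 ∧ f.2 w'.2 = f.2 w.2).card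
      : ℝ) ≤ F₁ * F₂ * (N₁ / M₁ + N₂ / M₂ + N / (M₁ * M₂)) := by
    intro w
    calc _ ≤ (((T.filter fun w' => w' ≠ w).biUnion (col w)).card : ℝ) := by
          gcongr
          intro f hf
          obtain ⟨-, w', hw', hne, he⟩ := Finset.mem_filter.1 hf
          exact Finset.mem_biUnion.2 ⟨w', Finset.mem_filter.2 ⟨hw', hne⟩,
            Finset.mem_filter.2 ⟨Finset.mem_univ _, he⟩⟩
      _ ≤ ∑ w' ∈ T with w' ≠ w, ((col w w').card : ℝ) := by exact_mod_cast Finset.card_biUnion_le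
      _ ≤ ∑ w' ∈ T with w' ≠ w, F₁ * F₂ * ((if w'.2 = w.2 then (1 / M₁ : ℝ) else 0)
          + (if w'.1 = w.1 then (1 / M₂ : ℝ) else 0) + 1 / (M₁ * M₂) : ℝ) :=
          Finset.sum_le_sum fun w' hw' => hcol w w' (Finset.mem_filter.1 hw').2
      _ ≤ ∑ w' ∈ T, F₁ * F₂ * ((if w'.2 = w.2 then (1 / M₁ : ℝ) else 0)
          + (if w'.1 = w.1 then (1 / M₂ : ℝ) else 0) + 1 / (M₁ * M₂) : ℝ) := by
          refine Finset.sum_le_sum_of_subset_of_nonneg (Finset.filter_subset _ _) fun w' _ _ => ?_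
          positivity
      _ = F₁ * F₂ * ((T.filter fun w' => w'.2 = w.2).card / M₁
          + (T.filter fun w' => w'.1 = w.1).card / M₂ + T.card / (M₁ * M₂)) := by
          rw [← Finset.mul_sum, Finset.sum_add_distrib, Finset.sum_add_distrib,
            ← Finset.sum_filter, ← Finset.sum_filter]
          simp only [Finset.sum_const, nsmul_eq_mul, mul_one_div]
      _ ≤ _ := by
          gcongr
          · exact hN₁ _
          · exact hN₂ _
  have havg : ∑ f ∈ D, ∑ w with ∃ w' ∈ T, w' ≠ w ∧ f.1 w'.1 = f.1 w.1 ∧ f.2 w'.2 = f.2 w.2, Q w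
      ≤ ∑ f ∈ D, (∑ w, Q w) * (N₁ / M₁ + N₂ / M₂ + N / (M₁ * M₂)) := by
    calc _ = ∑ w, Q w * (D.filter fun f =>
          ∃ w' ∈ T, w' ≠ w ∧ f.1 w'.1 = f.1 w.1 ∧ f.2 w'.2 = f.2 w.2).card := by
          simp only [Finset.sum_filter]
          rw [Finset.sum_comm]
          refine Finset.sum_congr rfl fun w _ => ?_
          rw [← Finset.sum_filter, Finset.sum_const, nsmul_eq_mul, mul_comm]
      _ ≤ ∑ w, Q w * (F₁ * F₂ * (N₁ / M₁ + N₂ / M₂ + N / (M₁ * M₂))) :=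
          Finset.sum_le_sum fun w _ => mul_le_mul_of_nonneg_left (hw w) (hQ w)
      _ = _ := by
          rw [← Finset.sum_mul, Finset.sum_const, nsmul_eq_mul, Finset.card_univ,
            Fintype.card_prod, Nat.cast_mul]
          ring
  obtain ⟨f, -, hf⟩ := Finset.exists_le_of_sum_le Finset.univ_nonempty havg
  exact ⟨f.1, f.2, hf⟩

/-- The one-shot direct part, for a decoder that does not know which of the laws `Q k`, `k ∈ 𝒦`, is
in force: it looks for an element of the union of the sets `T k` with the given bin indices. -/
lemma exists_code_of_family [DecidableEq X] [DecidableEq Y] {ι : Type*}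
    [Nonempty (X × Y)] (𝒦 : Finset ι) {Q : ι → X × Y → ℝ}
    {T : ι → Finset (X × Y)} (hQ : ∀ k w, 0 ≤ Q k w) (hQ1 : ∀ k, ∑ w, Q k w ≤ 1)
    {N N₁ N₂ : ℝ} {M₁ M₂ : ℕ} (hM₁ : 0 < M₁) (hM₂ : 0 < M₂)
    (hN : ∀ k ∈ 𝒦, ((T k).card : ℝ) ≤ N)
    (hN₁ : ∀ k ∈ 𝒦, ∀ y, (((T k).filter fun w => w.2 = y).card : ℝ) ≤ N₁)
    (hN₂ : ∀ k ∈ 𝒦, ∀ x, (((T k).filter fun w => w.1 = x).card : ℝ) ≤ N₂) :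
    ∃ (f₁ : X → Fin M₁) (f₂ : Y → Fin M₂) (φ : Fin M₁ × Fin M₂ → X × Y), ∀ k ∈ 𝒦,
      ∑ w with φ (f₁ w.1, f₂ w.2) ≠ w, Q k w ≤ ∑ w with w ∉ T k, Q k w
        + (𝒦.card : ℝ) ^ 2 * (N₁ / M₁ + N₂ / M₂ + N / (M₁ * M₂)) := by
  rcases 𝒦.eq_empty_or_nonempty with rfl | ⟨k₀, hk₀⟩
  · exact ⟨fun _ => ⟨0, hM₁⟩, fun _ => ⟨0, hM₂⟩, fun _ => Classical.arbitrary _, by simp⟩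
  have : Nonempty X := (Classical.arbitrary (X × Y)).1 |> Nonempty.intro
  have : Nonempty Y := (Classical.arbitrary (X × Y)).2 |> Nonempty.intro
  have hN0 : 0 ≤ N := (Nat.cast_nonneg _).trans (hN k₀ hk₀)
  have hN₁0 : 0 ≤ N₁ := (Nat.cast_nonneg _).trans (hN₁ k₀ hk₀ (Classical.arbitrary Y))
  have hN₂0 : 0 ≤ N₂ := (Nat.cast_nonneg _).trans (hN₂ k₀ hk₀ (Classical.arbitrary X))
  -- A union of `𝒦.card` sets, each with at most `a` elements satisfying `p`.
  have hunion : ∀ (p : X × Y → Prop) [DecidablePred p] (a : ℝ),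
      (∀ k ∈ 𝒦, (((T k).filter p).card : ℝ) ≤ a) →
      (((𝒦.biUnion T).filter p).card : ℝ) ≤ 𝒦.card * a := by
    intro p _ a hp
    rw [Finset.filter_biUnion]
    calc ((𝒦.biUnion fun k => (T k).filter p).card : ℝ) ≤ ∑ k ∈ 𝒦, (((T k).filter p).card : ℝ) := by
          exact_mod_cast Finset.card_biUnion_le
      _ ≤ 𝒦.card * a := by
          rw [← nsmul_eq_mul]
          exact Finset.sum_le_card_nsmul _ _ _ hp
  obtain ⟨f₁, f₂, hf⟩ := exists_binning (Q := fun w => ∑ k ∈ 𝒦, Q k w) (𝒦.biUnion T)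
    (fun w => Finset.sum_nonneg fun k _ => hQ k w) hM₁ hM₂
    (N := 𝒦.card * N) (N₁ := 𝒦.card * N₁) (N₂ := 𝒦.card * N₂)
    (by simpa using hunion (fun _ => True) N (by simpa using hN))
    (fun y => hunion _ _ fun k hk => hN₁ k hk y) (fun x => hunion _ _ fun k hk => hN₂ k hk x)
  let φ : Fin M₁ × Fin M₂ → X × Y := fun m =>
    if hm : ∃ w ∈ 𝒦.biUnion T, f₁ w.1 = m.1 ∧ f₂ w.2 = m.2 then hm.choose
    else Classical.arbitrary _
  refine ⟨f₁, f₂, φ, fun k hk => ?_⟩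
  set E := Finset.univ.filter fun w : X × Y =>
    ∃ w' ∈ 𝒦.biUnion T, w' ≠ w ∧ f₁ w'.1 = f₁ w.1 ∧ f₂ w'.2 = f₂ w.2
  have hsub : (Finset.univ.filter fun w : X × Y => φ (f₁ w.1, f₂ w.2) ≠ w)
      ⊆ (Finset.univ.filter fun w => w ∉ T k) ∪ E := by
    intro w hw
    simp only [Finset.mem_filter, Finset.mem_univ, true_and, Finset.mem_union, E] at hw ⊢
    by_contra! hcon
    have hm : ∃ w' ∈ 𝒦.biUnion T, f₁ w'.1 = f₁ w.1 ∧ f₂ w'.2 = f₂ w.2 :=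
      ⟨w, Finset.mem_biUnion.2 ⟨k, hk, hcon.1⟩, rfl, rfl⟩
    have hφ : φ (f₁ w.1, f₂ w.2) = hm.choose := dif_pos hm
    rw [hφ] at hw
    exact hcon.2 _ hm.choose_spec.1 hw hm.choose_spec.2.1 hm.choose_spec.2.2
  have hE : ∑ w ∈ E, Q k w ≤ (𝒦.card : ℝ) ^ 2 * (N₁ / M₁ + N₂ / M₂ + N / (M₁ * M₂)) := by
    calc ∑ w ∈ E, Q k w ≤ ∑ w ∈ E, ∑ k ∈ 𝒦, Q k w := Finset.sum_le_sum fun w _ =>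
          Finset.single_le_sum (f := fun k => Q k w) (fun k _ => hQ k w) hk
      _ ≤ _ := hf
      _ ≤ 𝒦.card * (𝒦.card * N₁ / M₁ + 𝒦.card * N₂ / M₂ + 𝒦.card * N / (M₁ * M₂)) := by
          gcongr
          rw [Finset.sum_comm, ← nsmul_one, ← Finset.sum_const]
          exact Finset.sum_le_sum fun k _ => hQ1 k
      _ = _ := by ring
  calc _ ≤ ∑ w ∈ (Finset.univ.filter fun w => w ∉ T k) ∪ E, Q k w :=
        Finset.sum_le_sum_of_subset_of_nonneg hsub fun w _ _ => hQ k w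
    _ ≤ ∑ w with w ∉ T k, Q k w + ∑ w ∈ E, Q k w := by
        rw [← Finset.sum_union_inter]
        exact le_add_of_nonneg_right (Finset.sum_nonneg fun w _ => hQ k w)
    _ ≤ _ := by gcongr

end OneShot

end AsyncSW

namespace AsyncSW

/-! ### The law of a pair of blocks -/

section Blocks

variable {α β : Type*}

lemma agreeProb_mono (P : PMF (α × β)) {a b a' b' : Prop} (ha : a' → a) (hb : b' → b)
    (z : α × β) : agreeProb P a b z ≤ agreeProb P a' b' z := by
  let _ : MeasurableSpace (α × β) := ⊤
  have : DiscreteMeasurableSpace (α × β) := ⟨fun _ => trivial⟩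
  rw [agreeProb_eq_measureReal, agreeProb_eq_measureReal]
  exact measureReal_mono fun w hw => ⟨fun h => hw.1 (ha h), fun h => hw.2 (hb h)⟩

lemma agreeEntropy_mono [Fintype α] [Fintype β] (P : PMF (α × β)) {a b a' b' : Prop}
    (ha : a' → a) (hb : b' → b) : agreeEntropy P a' b' ≤ agreeEntropy P a b := by
  refine Finset.sum_le_sum fun z _ => ?_
  by_cases hz : P z = 0
  · simp [hz]
  · gcongr
    · norm_num
    · exact agreeProb_pos P _ _ hz
    · exact agreeProb_mono P ha hb z

/-- The joint law of the blocks `X_1, …, X_n` and `Y_{1+k}, …, Y_{n+k}`. -/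
noncomputable def blockProb (P : PMF (α × β)) (n : ℕ) (k : ℤ)
    (w : (Fin n → α) × (Fin n → β)) : ℝ :=
  letI : MeasurableSpace (α × β) := ⊤
  (Measure.infinitePi fun _ : ℤ => P.toMeasure).real {ω | (blockX n ω, blockY n k ω) = w}

lemma blockProb_nonneg (P : PMF (α × β)) (n : ℕ) (k : ℤ) (w : (Fin n → α) × (Fin n → β)) :
    0 ≤ blockProb P n k w := measureReal_nonneg

lemma blockProb_eq [m : MeasurableSpace (α × β)] [DiscreteMeasurableSpace (α × β)]
    (P : PMF (α × β)) (n : ℕ) (k : ℤ) (w : (Fin n → α) × (Fin n → β)) :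
    blockProb P n k w = (Measure.infinitePi fun _ : ℤ => P.toMeasure).real
      {ω | (blockX n ω, blockY n k ω) = w} := by
  obtain rfl : m = ⊤ := top_unique fun s _ => .of_discrete
  rfl

lemma blockX_eq_iff {n : ℕ} {ω ω₀ : ℤ → α × β} :
    blockX n ω = blockX n ω₀ ↔ ∀ t ∈ Finset.Icc (1 : ℤ) n, (ω t).1 = (ω₀ t).1 := by
  rw [funext_iff]
  constructor
  · intro h t ht
    rw [Finset.mem_Icc] at ht
    have := h ⟨(t - 1).toNat, by omega⟩
    simp only [blockX] at this
    rwa [show (1 + ((t - 1).toNat : ℤ)) = t by omega] at this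
  · intro h i
    exact h _ (Finset.mem_Icc.2 (by omega))

lemma blockY_eq_iff {n : ℕ} {k : ℤ} {ω ω₀ : ℤ → α × β} :
    blockY n k ω = blockY n k ω₀ ↔ ∀ t ∈ Finset.Icc (1 + k) (n + k), (ω t).2 = (ω₀ t).2 := by
  rw [funext_iff]
  constructor
  · intro h t ht
    rw [Finset.mem_Icc] at ht
    have := h ⟨(t - 1 - k).toNat, by omega⟩
    simp only [blockY] at this
    rwa [show (1 + ((t - 1 - k).toNat : ℤ) + k) = t by omega] at this
  · intro h i
    exact h _ (Finset.mem_Icc.2 (by omega))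

lemma exists_block_eq [Nonempty (α × β)] {n : ℕ} (k : ℤ) (w : (Fin n → α) × (Fin n → β)) :
    ∃ ω : ℤ → α × β, (blockX n ω, blockY n k ω) = w := by
  obtain ⟨a, b⟩ := Classical.arbitrary (α × β)
  have hX : Function.Injective fun i : Fin n => 1 + (i : ℤ) := fun i j h => by
    simp only at h
    omega
  have hY : Function.Injective fun i : Fin n => 1 + (i : ℤ) + k := fun i j h => by
    simp only at h
    omega
  refine ⟨fun t => (Function.extend (fun i : Fin n => 1 + (i : ℤ)) w.1 (fun _ => a) t,
    Function.extend (fun i : Fin n => 1 + (i : ℤ) + k) w.2 (fun _ => b) t), ?_⟩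
  exact Prod.ext (funext fun i => hX.extend_apply w.1 (fun _ => a) i)
    (funext fun i => hY.extend_apply w.2 (fun _ => b) i)

lemma measurableSet_agreeSet [MeasurableSpace (α × β)] [DiscreteMeasurableSpace (α × β)]
    (A B : Finset ℤ) (ω₀ : ℤ → α × β) : MeasurableSet (agreeSet A B ω₀) := by
  have : agreeSet A B ω₀ = (⋂ t ∈ A, (fun ω => ω t) ⁻¹' {z | z.1 = (ω₀ t).1})
      ∩ ⋂ t ∈ B, (fun ω => ω t) ⁻¹' {z | z.2 = (ω₀ t).2} := by
    ext ω
    simp [agreeSet]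
  rw [this]
  exact (Finset.measurableSet_biInter _ fun t _ => measurable_pi_apply t .of_discrete).inter
    (Finset.measurableSet_biInter _ fun t _ => measurable_pi_apply t .of_discrete)

lemma setOf_block_eq (n : ℕ) (k : ℤ) (ω₀ : ℤ → α × β) :
    {ω | (blockX n ω, blockY n k ω) = (blockX n ω₀, blockY n k ω₀)}
      = agreeSet (Finset.Icc 1 (n : ℤ)) (Finset.Icc (1 + k) (n + k)) ω₀ := by
  ext ω
  simp only [Set.mem_ofPred_eq, Prod.mk.injEq, blockX_eq_iff, blockY_eq_iff, agreeSet]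


lemma iSup_singleton_errorProb (P : PMF (α × β)) (d : DelayBound) {n : ℕ} (c : Code α β n) :
    ⨆ P' ∈ ({P} : Set (PMF (α × β))), ⨆ k ∈ Set.Icc (d.lo n) (d.hi n), errorProb P' k c
      = ⨆ k ∈ Set.Icc (d.lo n) (d.hi n), errorProb P k c :=
  iSup_singleton

variable [Fintype α] [Fintype β]

lemma sum_blockProb [MeasurableSpace (α × β)] [DiscreteMeasurableSpace (α × β)]
    (P : PMF (α × β)) (n : ℕ) (k : ℤ) (p : (Fin n → α) × (Fin n → β) → Prop) [DecidablePred p] :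
    ∑ w with p w, blockProb P n k w
      = (Measure.infinitePi fun _ : ℤ => P.toMeasure).real
          {ω | p (blockX n ω, blockY n k ω)} := by
  have : Nonempty (α × β) := P.support_nonempty.to_type
  have h := sum_measureReal_preimage_singleton
    (μ := Measure.infinitePi fun _ : ℤ => P.toMeasure) (Finset.univ.filter p)
    (f := fun ω : ℤ → α × β => (blockX n ω, blockY n k ω)) (fun w _ => by
      obtain ⟨ω₀, rfl⟩ := exists_block_eq (α := α) (β := β) k w
      exact (congrArg MeasurableSet (setOf_block_eq n k ω₀)).mpr (measurableSet_agreeSet _ _ _))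
  simp only [blockProb_eq]
  refine h.trans ?_
  congr 1
  ext ω
  simp

lemma sum_blockProb_univ (P : PMF (α × β)) (n : ℕ) (k : ℤ) : ∑ w, blockProb P n k w = 1 := by
  let _ : MeasurableSpace (α × β) := ⊤
  have : DiscreteMeasurableSpace (α × β) := ⟨fun _ => trivial⟩
  have h := sum_blockProb P n k fun _ => True
  simpa using h

open Classical in
lemma errorProb_eq (P : PMF (α × β)) {n : ℕ} (k : ℤ) (c : Code α β n) :
    errorProb P k c = ENNReal.ofReal
      (∑ w with c.dec (c.enc₁ w.1, c.enc₂ w.2) ≠ w, blockProb P n k w) := by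
  let _ : MeasurableSpace (α × β) := ⊤
  have : DiscreteMeasurableSpace (α × β) := ⟨fun _ => trivial⟩
  rw [sum_blockProb, ofReal_measureReal]
  rfl

open Classical in
/-- The pair of blocks is typical with high probability. Its entropy is `n H(X,Y) + |k| I(X;Y)`,
since only `n - |k|` of the positions of the two blocks overlap. -/
lemma exists_sum_not_typicalSet_le (P : PMF (α × β)) :
    ∃ K : ℝ, 0 ≤ K ∧ ∀ (n : ℕ) (k : ℤ) (c : ℝ), |k| ≤ n → 0 < c →
      ∑ w with w ∉ typicalSet (blockProb P n k)
        (n * agreeEntropy P True True + |(k : ℝ)| * mutualInfo P)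
        (n * agreeEntropy P True False) (n * agreeEntropy P False True) c, blockProb P n k w
      ≤ n * K / c ^ 2 := by
  let _ : MeasurableSpace (α × β) := ⊤
  have : DiscreteMeasurableSpace (α × β) := ⟨fun _ => trivial⟩
  obtain ⟨K, hK0, hK⟩ := exists_equipartition P
  refine ⟨4 * K, by positivity, fun n k c hk hc => ?_⟩
  set μ := Measure.infinitePi fun _ : ℤ => P.toMeasure with hμ
  set A := Finset.Icc 1 (n : ℤ) with hA
  set B := Finset.Icc (1 + k) (n + k) with hB
  have cA : A.card = n := by simp [hA]
  have cB : B.card = n := by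
    rw [hB, Int.card_Icc]
    omega
  have cAB : ((A ∩ B).card : ℝ) = n - |(k : ℝ)| := by
    have h1 : A ∩ B = Finset.Icc (max 1 (1 + k)) (min n (n + k)) := by
      ext t
      simp only [hA, hB, Finset.mem_inter, Finset.mem_Icc, max_le_iff, le_min_iff]
      tauto
    have h2 : ((A ∩ B).card : ℤ) = n - |k| := by
      rw [h1, Int.card_Icc]
      rcases abs_cases k with ⟨h, _⟩ | ⟨h, _⟩ <;> omega
    exact_mod_cast h2
  have e1 := hK A B (n * agreeEntropy P True True + |(k : ℝ)| * mutualInfo P) c hc (by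
    rw [cA, cB, cAB, mutualInfo_eq]
    ring)
  have e2 := hK A ∅ (n * agreeEntropy P True False) c hc (by simp [cA])
  have e3 := hK ∅ B (n * agreeEntropy P False True) c hc (by simp [cB])
  have hQ : ∀ ω, blockProb P n k (blockX n ω, blockY n k ω) = μ.real (agreeSet A B ω) := fun ω => by
    rw [hA, hB, ← setOf_block_eq]
    rfl
  have hQX : ∀ ω, ∑ y, blockProb P n k (blockX n ω, y) = μ.real (agreeSet A ∅ ω) := fun ω => by
    have h := sum_blockProb P n k fun w => w.1 = blockX n ω
    rw [Finset.sum_filter, Fintype.sum_prod_type_right] at h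
    simp only [Finset.sum_ite_eq', Finset.mem_univ, if_true] at h
    rw [h]
    congr 1
    ext ω'
    simp [agreeSet, blockX_eq_iff, hA]
  have hQY : ∀ ω, ∑ x, blockProb P n k (x, blockY n k ω) = μ.real (agreeSet ∅ B ω) := fun ω => by
    have h := sum_blockProb P n k fun w => w.2 = blockY n k ω
    rw [Finset.sum_filter, Fintype.sum_prod_type] at h
    simp only [Finset.sum_ite_eq', Finset.mem_univ, if_true] at h
    rw [h]
    congr 1
    ext ω'
    simp [agreeSet, blockY_eq_iff, hB]
  rw [sum_blockProb]
  simp only [mem_typicalSet, hQ, hQX, hQY]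
  refine (measureReal_mono (fun ω hω => ?_)).trans ((measureReal_union_le _ _).trans
    ((add_le_add ((measureReal_union_le _ _).trans (add_le_add e1 e2)) e3).trans (le_of_eq ?_)))
  · simp only [Set.mem_union, Set.mem_ofPred_eq] at hω ⊢
    tauto
  · simp only [cA, cB, Finset.card_empty, Nat.cast_zero]
    ring

end Blocks

/-! ### The converse -/

section Asymptotics

variable {α β : Type*} [Fintype α] [Fintype β]

open Classical in
lemma Code.injOn_enc {n : ℕ} (c : Code α β n) :
    Set.InjOn (fun w : (Fin n → α) × (Fin n → β) => (c.enc₁ w.1, c.enc₂ w.2))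
      (Finset.univ.filter fun w => c.dec (c.enc₁ w.1, c.enc₂ w.2) = w : Finset _) := by
  intro w hw w' hw' he
  simp only [Finset.coe_filter, Finset.mem_univ, true_and, Set.mem_ofPred_eq] at hw hw'
  rw [← hw, ← hw']
  exact congrArg c.dec he

lemma tendsto_rpow_neg_mul {δ : ℝ} (hδ : 0 < δ) :
    Tendsto (fun n : ℕ => (2 : ℝ) ^ (-(δ * n))) atTop (𝓝 0) := by
  have h : ∀ n : ℕ, (2 : ℝ) ^ (-(δ * n)) = ((2 : ℝ) ^ (-δ)) ^ n := fun n => by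
    rw [← Real.rpow_natCast, ← Real.rpow_mul zero_le_two, neg_mul]
  simp only [h]
  exact tendsto_pow_atTop_nhds_zero_of_lt_one (by positivity)
    (Real.rpow_lt_one_of_one_lt_of_neg one_lt_two (by linarith))

lemma tendsto_mul_div_mul_sq (K : ℝ) {δ : ℝ} (hδ : 0 < δ) :
    Tendsto (fun n : ℕ => n * K / (δ * n) ^ 2) atTop (𝓝 0) := by
  have h : Tendsto (fun n : ℕ => K / δ ^ 2 / (n : ℝ)) atTop (𝓝 0) :=
    tendsto_const_div_atTop_nhds_zero_nat _
  refine h.congr' ?_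
  filter_upwards [eventually_gt_atTop 0] with n hn
  have : (n : ℝ) ≠ 0 := by positivity
  field_simp

lemma DelayBound.abs_le (d : DelayBound) {n : ℕ} (hn : 1 ≤ n) {k : ℤ}
    (hk : k ∈ Set.Icc (d.lo n) (d.hi n)) : |k| ≤ n :=
  _root_.abs_le.2 ⟨(d.neg_le_lo n hn).trans hk.1, hk.2.trans (d.hi_le n hn)⟩

/-- The rates of reliable codes are at least the entropy rates of the delayed pair of blocks, up
to an arbitrarily small slack. -/
lemma Achievable.eventually_le {P : PMF (α × β)} {d : DelayBound} {R₁ R₂ : ℝ}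
    (hach : Achievable {P} d R₁ R₂) {δ : ℝ} (hδ : 0 < δ) :
    ∀ᶠ n : ℕ in atTop, ∀ k ∈ Set.Icc (d.lo n) (d.hi n),
      n * agreeEntropy P True True + |(k : ℝ)| * mutualInfo P ≤ n * (R₁ + R₂ + 4 * δ) ∧
      n * (agreeEntropy P True True - agreeEntropy P False True) + |(k : ℝ)| * mutualInfo P
        ≤ n * (R₁ + 4 * δ) ∧
      n * (agreeEntropy P True True - agreeEntropy P True False) + |(k : ℝ)| * mutualInfo P
        ≤ n * (R₂ + 4 * δ) := by
  classical
  obtain ⟨c, hr₁, hr₂, herr⟩ := hach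
  obtain ⟨K, hK0, hK⟩ := exists_sum_not_typicalSet_le P
  have hev₁ : ∀ᶠ n in atTop, (((c n).rate₁ : ℝ) : EReal) < ((R₁ + δ : ℝ) : EReal) :=
    eventually_lt_of_limsup_lt (hr₁.trans_lt (EReal.coe_lt_coe_iff.2 (by linarith)))
  have hev₂ : ∀ᶠ n in atTop, (((c n).rate₂ : ℝ) : EReal) < ((R₂ + δ : ℝ) : EReal) :=
    eventually_lt_of_limsup_lt (hr₂.trans_lt (EReal.coe_lt_coe_iff.2 (by linarith)))
  have hev₃ := herr.eventually_lt_const (u := ENNReal.ofReal (1 / 4)) (by simp)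
  have hev₄ := (tendsto_mul_div_mul_sq K hδ).eventually_lt_const (u := 1 / 4) (by norm_num)
  have hev₅ := (tendsto_rpow_neg_mul hδ).eventually_lt_const (u := 1 / 2) (by norm_num)
  filter_upwards [hev₁, hev₂, hev₃, hev₄, hev₅, eventually_ge_atTop 1] with n h1 h2 h3 h4 h5 hn k hk
  have hn0 : (0 : ℝ) < n := by exact_mod_cast hn
  rw [EReal.coe_lt_coe_iff] at h1 h2
  have hM : ∀ (M : ℕ) (R : ℝ), 0 < M → Real.logb 2 M / n < R → (M : ℝ) ≤ (2 : ℝ) ^ (n * R) := by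
    intro M R hM0 hR
    rw [div_lt_iff₀ hn0] at hR
    rw [← Real.logb_le_iff_le_rpow one_lt_two (by exact_mod_cast hM0), mul_comm]
    exact hR.le
  have hM₁ := hM _ _ (c n).M₁_pos h1
  have hM₂ := hM _ _ (c n).M₂_pos h2
  have he : ∑ w with (c n).dec ((c n).enc₁ w.1, (c n).enc₂ w.2) ≠ w, blockProb P n k w < 1 / 4 := by
    rw [iSup_singleton_errorProb] at h3
    have := (le_iSup₂ (f := fun k (_ : k ∈ Set.Icc (d.lo n) (d.hi n)) => errorProb P k (c n))
      k hk).trans_lt h3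
    simp only [errorProb_eq] at this
    exact (ENNReal.ofReal_lt_ofReal_iff (by norm_num)).1 this
  have htyp := (hK n k (δ * n) (d.abs_le hn hk) (by positivity)).trans h4.le
  have hsucc := Finset.sum_filter_add_sum_filter_not Finset.univ
    (fun w : (Fin n → α) × (Fin n → β) => (c n).dec ((c n).enc₁ w.1, (c n).enc₂ w.2) = w)
    (blockProb P n k)
  rw [sum_blockProb_univ] at hsucc
  have hsucc' : 3 / 4 < ∑ w with (c n).dec ((c n).enc₁ w.1, (c n).enc₂ w.2) = w,
      blockProb P n k w := by linarith
  obtain ⟨b0, b1, b2⟩ := sum_le_of_injOn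
    (h := n * agreeEntropy P True True + |(k : ℝ)| * mutualInfo P)
    (h₁ := n * agreeEntropy P True False) (h₂ := n * agreeEntropy P False True) (c := δ * n)
    (blockProb_nonneg P n k) (sum_blockProb_univ P n k).le (c n).injOn_enc
  -- A bound `1 / 2 ≤ 2 ^ a * 2 ^ b` is incompatible with `a + b ≤ -δ n`.
  have hexp : ∀ a b : ℝ, 1 / 2 ≤ (2 : ℝ) ^ a * (2 : ℝ) ^ b → -(δ * n) < a + b := by
    intro a b hab
    rw [← Real.rpow_add two_pos] at hab
    exact (Real.rpow_lt_rpow_left_iff one_lt_two).1 (h5.trans_le hab)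
  refine ⟨?_, ?_, ?_⟩
  · have hp : ((c n).M₁ : ℝ) * (c n).M₂ ≤ (2 : ℝ) ^ (n * (R₁ + δ) + n * (R₂ + δ)) := by
      rw [Real.rpow_add two_pos]
      gcongr
    have := hexp _ _ (le_trans (by linarith) (mul_le_mul_of_nonneg_right hp
      (Real.rpow_nonneg zero_le_two
        (-(n * agreeEntropy P True True + |(k : ℝ)| * mutualInfo P - δ * n)))))
    linarith
  · have := hexp _ _ (le_trans (by linarith) (mul_le_mul_of_nonneg_right hM₁
      (Real.rpow_nonneg zero_le_two (-(n * agreeEntropy P True True + |(k : ℝ)| * mutualInfo P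
        - n * agreeEntropy P False True - 2 * (δ * n))))))
    linarith
  · have := hexp _ _ (le_trans (by linarith) (mul_le_mul_of_nonneg_right hM₂
      (Real.rpow_nonneg zero_le_two (-(n * agreeEntropy P True True + |(k : ℝ)| * mutualInfo P
        - n * agreeEntropy P True False - 2 * (δ * n))))))
    linarith

/-- The Slepian–Wolf region: `R₁ ≥ H(X|Y)`, `R₂ ≥ H(Y|X)` and `R₁ + R₂ ≥ H(X,Y)`. -/
def slepianWolfRegion (P : PMF (α × β)) : Set (ℝ × ℝ) :=
  {R | agreeEntropy P True True - agreeEntropy P False True ≤ R.1 ∧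
    agreeEntropy P True True - agreeEntropy P True False ≤ R.2 ∧
    agreeEntropy P True True ≤ R.1 + R.2}

lemma Achievable.entropy_add_le {P : PMF (α × β)} {d : DelayBound} {R₁ R₂ : ℝ}
    (hach : Achievable {P} d R₁ R₂) {a : ℝ}
    (ha : ∃ᶠ n : ℕ in atTop, ∃ k ∈ Set.Icc (d.lo n) (d.hi n), a * n ≤ |(k : ℝ)| * mutualInfo P) :
    agreeEntropy P True True + a ≤ R₁ + R₂ ∧
    agreeEntropy P True True - agreeEntropy P False True + a ≤ R₁ ∧
    agreeEntropy P True True - agreeEntropy P True False + a ≤ R₂ := by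
  have key : ∀ ε > 0, agreeEntropy P True True + a ≤ R₁ + R₂ + ε ∧
      agreeEntropy P True True - agreeEntropy P False True + a ≤ R₁ + ε ∧
      agreeEntropy P True True - agreeEntropy P True False + a ≤ R₂ + ε := by
    intro ε hε
    obtain ⟨n, ⟨⟨k, hk, hka⟩, h⟩, hn⟩ := ((ha.and_eventually
      (hach.eventually_le (δ := ε / 4) (by positivity))).and_eventually
      (eventually_ge_atTop 1)).exists
    have hn0 : (0 : ℝ) < n := by exact_mod_cast hn
    obtain ⟨h0, h1, h2⟩ := h k hk
    refine ⟨le_of_mul_le_mul_left ?_ hn0, le_of_mul_le_mul_left ?_ hn0,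
      le_of_mul_le_mul_left ?_ hn0⟩ <;> linarith
  exact ⟨le_of_forall_pos_le_add fun ε hε => (key ε hε).1,
    le_of_forall_pos_le_add fun ε hε => (key ε hε).2.1,
    le_of_forall_pos_le_add fun ε hε => (key ε hε).2.2⟩

lemma rateRegion_subset_slepianWolfRegion (P : PMF (α × β)) (d : DelayBound) :
    rateRegion {P} d ⊆ slepianWolfRegion P := by
  intro R hR
  have := Achievable.entropy_add_le (a := 0) hR (((eventually_ge_atTop 1).mono fun n hn =>
    ⟨d.lo n, ⟨le_rfl, d.lo_le_hi n hn⟩, by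
      rw [zero_mul]
      exact mul_nonneg (abs_nonneg _) (mutualInfo_nonneg P)⟩).frequently)
  simp only [add_zero] at this
  exact ⟨this.2.1, this.2.2, this.1⟩

/-! ### The direct part -/

lemma logb_ceil_rpow_le {a : ℝ} (ha : 0 ≤ a) : Real.logb 2 ⌈(2 : ℝ) ^ a⌉₊ ≤ a + 1 := by
  have h1 : (1 : ℝ) ≤ (2 : ℝ) ^ a := Real.one_le_rpow one_le_two ha
  have h2 : (⌈(2 : ℝ) ^ a⌉₊ : ℝ) < (2 : ℝ) ^ a + 1 := Nat.ceil_lt_add_one (by positivity)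
  rw [Real.logb_le_iff_le_rpow one_lt_two (by exact_mod_cast Nat.ceil_pos.2 (by positivity)),
    Real.rpow_add two_pos, Real.rpow_one]
  linarith

lemma tendsto_binning_error {δ : ℝ} (hδ : 0 < δ) :
    Tendsto (fun n : ℕ => (2 * (n : ℝ) + 1) ^ 2 * (3 * (2 : ℝ) ^ (-(δ * n)))) atTop (𝓝 0) := by
  have hr : |(2 : ℝ) ^ (-δ)| < 1 := by
    rw [abs_of_pos (by positivity)]
    exact Real.rpow_lt_one_of_one_lt_of_neg one_lt_two (by linarith)
  have h : Tendsto (fun n : ℕ => 12 * ((n : ℝ) ^ 2 * ((2 : ℝ) ^ (-δ)) ^ n)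
      + 12 * ((n : ℝ) ^ 1 * ((2 : ℝ) ^ (-δ)) ^ n) + 3 * ((n : ℝ) ^ 0 * ((2 : ℝ) ^ (-δ)) ^ n))
      atTop (𝓝 (12 * 0 + 12 * 0 + 3 * 0)) :=
    (((tendsto_pow_const_mul_const_pow_of_abs_lt_one 2 hr).const_mul 12).add
      ((tendsto_pow_const_mul_const_pow_of_abs_lt_one 1 hr).const_mul 12)).add
      ((tendsto_pow_const_mul_const_pow_of_abs_lt_one 0 hr).const_mul 3)
  simp only [mul_zero, add_zero] at h
  refine h.congr fun n => ?_
  rw [show -(δ * n) = -δ * n by ring, Real.rpow_mul zero_le_two, Real.rpow_natCast]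
  ring

set_option maxHeartbeats 800000 in
/-- If the delays are too short to change the entropy rate of the pair of blocks, every point of
the Slepian–Wolf region is approached by codes for all long blocklengths. -/
lemma eventually_exists_code {P : PMF (α × β)} {d : DelayBound} {R₁ R₂ : ℝ}
    (hR : (R₁, R₂) ∈ slepianWolfRegion P)
    (hd : ∀ δ > 0, ∀ᶠ n : ℕ in atTop, ∀ k ∈ Set.Icc (d.lo n) (d.hi n),
      |(k : ℝ)| * mutualInfo P ≤ δ * n) {ε : ℝ} (hε : 0 < ε) :
    ∀ᶠ n : ℕ in atTop, ∃ c : Code α β n, c.rate₁ ≤ R₁ + ε ∧ c.rate₂ ≤ R₂ + ε ∧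
      ∀ k ∈ Set.Icc (d.lo n) (d.hi n), errorProb P k c ≤ ENNReal.ofReal ε := by
  classical
  obtain ⟨h1, h2, h12⟩ := hR
  simp only at h1 h2 h12
  have : Nonempty (α × β) := P.support_nonempty.to_type
  obtain ⟨K, hK0, hK⟩ := exists_sum_not_typicalSet_le P
  have hR₁ : 0 ≤ R₁ := le_trans (sub_nonneg.2 (agreeEntropy_mono P (by simp) (by simp))) h1
  have hR₂ : 0 ≤ R₂ := le_trans (sub_nonneg.2 (agreeEntropy_mono P (by simp) (by simp))) h2
  obtain ⟨δ, hδ, rfl⟩ : ∃ δ : ℝ, 0 < δ ∧ ε = 6 * δ := ⟨ε / 6, by positivity, by ring⟩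
  have hev₁ := (tendsto_mul_div_mul_sq K hδ).eventually_lt_const (u := 3 * δ) (by positivity)
  have hev₂ := (tendsto_binning_error hδ).eventually_lt_const (u := 3 * δ) (by positivity)
  have hev₃ := (tendsto_const_div_atTop_nhds_zero_nat (1 : ℝ)).eventually_lt_const hδ
  filter_upwards [hev₁, hev₂, hev₃, hd δ hδ, eventually_ge_atTop 1] with n e1 e2 e3 hdk hn
  have hn0 : (0 : ℝ) < n := by exact_mod_cast hn
  have hδn : 0 ≤ δ * n := by positivity
  set M₁ := ⌈(2 : ℝ) ^ (n * (R₁ + 5 * δ))⌉₊ with hM₁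
  set M₂ := ⌈(2 : ℝ) ^ (n * (R₂ + 5 * δ))⌉₊ with hM₂
  have hM₁pos : 0 < M₁ := Nat.ceil_pos.2 (by positivity)
  have hM₂pos : 0 < M₂ := Nat.ceil_pos.2 (by positivity)
  have hM₁le : (2 : ℝ) ^ (n * (R₁ + 5 * δ)) ≤ M₁ := Nat.le_ceil _
  have hM₂le : (2 : ℝ) ^ (n * (R₂ + 5 * δ)) ≤ M₂ := Nat.le_ceil _
  have hrate : ∀ R : ℝ, 0 ≤ R →
      Real.logb 2 ⌈(2 : ℝ) ^ (n * (R + 5 * δ))⌉₊ / n ≤ R + 6 * δ := by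
    intro R hR
    rw [div_lt_iff₀ hn0] at e3
    rw [div_le_iff₀ hn0]
    refine (logb_ceil_rpow_le (by positivity)).trans ?_
    linarith
  set T : ℤ → Finset ((Fin n → α) × (Fin n → β)) := fun k => typicalSet (blockProb P n k)
    (n * agreeEntropy P True True + |(k : ℝ)| * mutualInfo P)
    (n * agreeEntropy P True False) (n * agreeEntropy P False True) (δ * n) with hT
  have : Nonempty α := (Classical.arbitrary (α × β)).1 |> Nonempty.intro
  have : Nonempty β := (Classical.arbitrary (α × β)).2 |> Nonempty.intro
  have hmono : ∀ a b : ℝ, a ≤ b → (2 : ℝ) ^ a ≤ (2 : ℝ) ^ b := fun a b hab =>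
    Real.rpow_le_rpow_of_exponent_le one_le_two hab
  obtain ⟨f₁, f₂, φ, hφ⟩ := exists_code_of_family (Finset.Icc (d.lo n) (d.hi n))
    (Q := blockProb P n) (T := T) (blockProb_nonneg P n) (fun k => (sum_blockProb_univ P n k).le)
    hM₁pos hM₂pos
    (N := (2 : ℝ) ^ (n * (R₁ + R₂) + 2 * (δ * n))) (N₁ := (2 : ℝ) ^ (n * R₁ + 3 * (δ * n)))
    (N₂ := (2 : ℝ) ^ (n * R₂ + 3 * (δ * n)))
    (fun k hk => (card_typicalSet_le (blockProb_nonneg P n k)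
      (sum_blockProb_univ P n k).le).trans (hmono _ _ (by
        have := hdk k (by simpa using hk)
        have := mul_le_mul_of_nonneg_left h12 hn0.le
        linarith)))
    (fun k hk y => (card_typicalSet_snd_eq_le (blockProb_nonneg P n k) y).trans (hmono _ _ (by
        have := hdk k (by simpa using hk)
        have := mul_le_mul_of_nonneg_left h1 hn0.le
        linarith)))
    (fun k hk x => (card_typicalSet_fst_eq_le (blockProb_nonneg P n k) x).trans (hmono _ _ (by
        have := hdk k (by simpa using hk)
        have := mul_le_mul_of_nonneg_left h2 hn0.le
        linarith)))
  refine ⟨⟨M₁, M₂, hM₁pos, hM₂pos, f₁, f₂, φ⟩, hrate R₁ hR₁, hrate R₂ hR₂, fun k hk => ?_⟩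
  rw [errorProb_eq]
  refine ENNReal.ofReal_le_ofReal ((hφ k (by simpa using hk)).trans ?_)
  have htyp := hK n k (δ * n) (d.abs_le hn hk) (by positivity)
  have hcard : ((Finset.Icc (d.lo n) (d.hi n)).card : ℝ) ≤ 2 * n + 1 := by
    have h : ((Finset.Icc (d.lo n) (d.hi n)).card : ℤ) ≤ 2 * n + 1 := by
      have := d.neg_le_lo n hn
      have := d.hi_le n hn
      rw [Int.card_Icc]
      omega
    exact_mod_cast h
  have hdiv : ∀ {a b M : ℝ}, (2 : ℝ) ^ b ≤ M → a - b ≤ -(δ * n) →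
      (2 : ℝ) ^ a / M ≤ (2 : ℝ) ^ (-(δ * n)) := by
    intro a b M hb hab
    refine (div_le_div_of_nonneg_left (by positivity) (by positivity) hb).trans ?_
    rw [← Real.rpow_sub two_pos]
    exact hmono _ _ hab
  have hM₁₂ : (2 : ℝ) ^ (n * (R₁ + 5 * δ) + n * (R₂ + 5 * δ)) ≤ M₁ * M₂ := by
    rw [Real.rpow_add two_pos]
    gcongr
  have hbin : ((Finset.Icc (d.lo n) (d.hi n)).card : ℝ) ^ 2
      * ((2 : ℝ) ^ (n * R₁ + 3 * (δ * n)) / M₁ + (2 : ℝ) ^ (n * R₂ + 3 * (δ * n)) / M₂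
        + (2 : ℝ) ^ (n * (R₁ + R₂) + 2 * (δ * n)) / (M₁ * M₂))
      ≤ (2 * (n : ℝ) + 1) ^ 2 * (3 * (2 : ℝ) ^ (-(δ * n))) := by
    gcongr
    have i1 := hdiv (a := n * R₁ + 3 * (δ * n)) hM₁le (by linarith)
    have i2 := hdiv (a := n * R₂ + 3 * (δ * n)) hM₂le (by linarith)
    have i3 := hdiv (a := n * (R₁ + R₂) + 2 * (δ * n)) hM₁₂ (by linarith)
    linarith
  linarith

/-- A diagonal sequence: if for every `ε > 0` there are objects with quality `ε` for all large `n`,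
some sequence has a quality that tends to `0`. -/
lemma exists_diagonal {C : ℕ → Type*} [∀ n, Nonempty (C n)] {p : ∀ n, ℝ → C n → Prop}
    (hp : ∀ ε > 0, ∀ᶠ n in atTop, ∃ c, p n ε c) :
    ∃ (c : ∀ n, C n) (ε : ℕ → ℝ), Tendsto ε atTop (𝓝 0) ∧ ∀ᶠ n in atTop, p n (ε n) (c n) := by
  choose N hN using fun m : ℕ => eventually_atTop.1 (hp (1 / ((m : ℝ) + 1)) (by positivity))
  set m : ℕ → ℕ := fun n => Nat.findGreatest (fun m => N m ≤ n) n with hm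
  have hex : ∀ n, ∃ c : C n, N 0 ≤ n → p n (1 / ((m n : ℝ) + 1)) c := by
    intro n
    by_cases hn : N 0 ≤ n
    · obtain ⟨c, hc⟩ := hN (m n) n
        (Nat.findGreatest_spec (P := fun m => N m ≤ n) (Nat.zero_le n) hn)
      exact ⟨c, fun _ => hc⟩
    · exact ⟨Classical.arbitrary _, fun h => absurd h hn⟩
  choose c hc using hex
  have hmt : Tendsto m atTop atTop := tendsto_atTop.2 fun j => by
    filter_upwards [eventually_ge_atTop (max j (N j))] with n hn
    exact Nat.le_findGreatest (le_of_max_le_left hn) (le_of_max_le_right hn)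
  exact ⟨c, fun n => 1 / ((m n : ℝ) + 1), tendsto_one_div_add_atTop_nhds_zero_nat.comp hmt,
    (eventually_ge_atTop (N 0)).mono hc⟩

lemma slepianWolfRegion_subset_rateRegion {P : PMF (α × β)} {d : DelayBound}
    (hd : ∀ δ > 0, ∀ᶠ n : ℕ in atTop, ∀ k ∈ Set.Icc (d.lo n) (d.hi n),
      |(k : ℝ)| * mutualInfo P ≤ δ * n) :
    slepianWolfRegion P ⊆ rateRegion {P} d := by
  rintro ⟨R₁, R₂⟩ hR
  have : Nonempty (α × β) := P.support_nonempty.to_type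
  have hne : ∀ n, Nonempty (Code α β n) := fun n =>
    ⟨⟨1, 1, one_pos, one_pos, fun _ => 0, fun _ => 0,
      fun _ => (fun _ => (Classical.arbitrary (α × β)).1,
        fun _ => (Classical.arbitrary (α × β)).2)⟩⟩
  obtain ⟨c, ε, hε, hc⟩ := exists_diagonal (C := Code α β)
    (p := fun n ε c => c.rate₁ ≤ R₁ + ε ∧ c.rate₂ ≤ R₂ + ε ∧
      ∀ k ∈ Set.Icc (d.lo n) (d.hi n), errorProb P k c ≤ ENNReal.ofReal ε)
    fun ε hε => eventually_exists_code hR hd hε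
  have hlim : ∀ R : ℝ, limsup (fun n => ((R + ε n : ℝ) : EReal)) atTop = (R : EReal) := fun R => by
    have h : Tendsto (fun n => R + ε n) atTop (𝓝 R) := by simpa using hε.const_add R
    exact ((continuous_coe_real_ereal.tendsto R).comp h).limsup_eq
  refine ⟨c, ?_, ?_, ?_⟩
  · rw [← hlim]
    exact limsup_le_limsup (hc.mono fun n h => EReal.coe_le_coe_iff.2 h.1)
  · rw [← hlim]
    exact limsup_le_limsup (hc.mono fun n h => EReal.coe_le_coe_iff.2 h.2.1)
  · have hε' : Tendsto (fun n => ENNReal.ofReal (ε n)) atTop (𝓝 0) := by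
      simpa using ENNReal.tendsto_ofReal hε
    refine tendsto_of_tendsto_of_tendsto_of_le_of_le' tendsto_const_nhds hε'
      (.of_forall fun _ => zero_le) (hc.mono fun n h => ?_)
    rw [iSup_singleton_errorProb]
    exact iSup₂_le h.2.2

/-! ### Delays of linear order -/

lemma DelayBound.ratio_bounds (d : DelayBound) :
    ∀ᶠ n : ℕ in atTop, 0 ≤ (max |(d.hi n : ℝ)| |(d.lo n : ℝ)|) / (n : ℝ) ∧
      (max |(d.hi n : ℝ)| |(d.lo n : ℝ)|) / (n : ℝ) ≤ 1 := by
  filter_upwards [eventually_ge_atTop 1] with n hn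
  have h1 : |(d.hi n : ℝ)| ≤ n := by
    exact_mod_cast d.abs_le hn ⟨d.lo_le_hi n hn, le_rfl⟩
  have h2 : |(d.lo n : ℝ)| ≤ n := by
    exact_mod_cast d.abs_le hn ⟨le_rfl, d.lo_le_hi n hn⟩
  exact ⟨by positivity, div_le_one_of_le₀ (max_le h1 h2) (by positivity)⟩

lemma DelayBound.isBoundedUnder (d : DelayBound) : IsBoundedUnder (· ≤ ·) atTop
    fun n : ℕ => (max |(d.hi n : ℝ)| |(d.lo n : ℝ)|) / (n : ℝ) :=
  isBoundedUnder_of_eventually_le (d.ratio_bounds.mono fun _ h => h.2)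

lemma DelayBound.isCoboundedUnder (d : DelayBound) : IsCoboundedUnder (· ≤ ·) atTop
    fun n : ℕ => (max |(d.hi n : ℝ)| |(d.lo n : ℝ)|) / (n : ℝ) :=
  (isBoundedUnder_of_eventually_ge (d.ratio_bounds.mono fun _ h => h.1)).isCoboundedUnder_le

lemma DelayBound.ratio_nonneg (d : DelayBound) : 0 ≤ d.ratio :=
  le_limsup_of_frequently_le (d.ratio_bounds.mono fun _ h => h.1).frequently d.isBoundedUnder

lemma DelayBound.ratio_zero : DelayBound.zero.ratio = 0 := by
  simp [DelayBound.ratio, DelayBound.zero]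

lemma rateRegion_eq_slepianWolfRegion {P : PMF (α × β)} {d : DelayBound}
    (h : d.ratio = 0 ∨ mutualInfo P = 0) : rateRegion {P} d = slepianWolfRegion P := by
  refine (rateRegion_subset_slepianWolfRegion P d).antisymm
    (slepianWolfRegion_subset_rateRegion fun δ hδ => ?_)
  rcases h with h | h
  · have hI := mutualInfo_nonneg P
    have hI1 : 0 < mutualInfo P + 1 := by linarith
    filter_upwards [eventually_lt_of_limsup_lt (h.trans_lt (div_pos hδ hI1)) d.isBoundedUnder,
      eventually_ge_atTop 1] with n hr hn k hk
    have hn0 : (0 : ℝ) < n := by exact_mod_cast hn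
    rw [div_lt_div_iff₀ hn0 hI1] at hr
    have hkmax : |(k : ℝ)| ≤ max |(d.hi n : ℝ)| |(d.lo n : ℝ)| := by
      rw [max_comm]
      exact abs_le_max_abs_abs (by exact_mod_cast hk.1) (by exact_mod_cast hk.2)
    calc |(k : ℝ)| * mutualInfo P
        ≤ max |(d.hi n : ℝ)| |(d.lo n : ℝ)| * (mutualInfo P + 1) := by gcongr; linarith
      _ ≤ δ * n := hr.le
  · exact .of_forall fun n k _ => by
      rw [h, mul_zero]
      positivity

/-- Delays of linear order, together with dependence, strictly raise the necessary sum rate. -/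
lemma entropy_lt_of_achievable {P : PMF (α × β)} {d : DelayBound} (hd : d.ratio ≠ 0)
    (hI : mutualInfo P ≠ 0) {R₁ R₂ : ℝ} (hach : Achievable {P} d R₁ R₂) :
    agreeEntropy P True True < R₁ + R₂ := by
  have hd0 : 0 < d.ratio := lt_of_le_of_ne d.ratio_nonneg (Ne.symm hd)
  have hI0 : 0 < mutualInfo P := lt_of_le_of_ne (mutualInfo_nonneg P) (Ne.symm hI)
  have hfreq : ∃ᶠ n : ℕ in atTop,
      d.ratio / 2 < (max |(d.hi n : ℝ)| |(d.lo n : ℝ)|) / (n : ℝ) :=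
    frequently_lt_of_lt_limsup d.isCoboundedUnder (half_lt_self hd0)
  have := (hach.entropy_add_le (a := d.ratio / 2 * mutualInfo P)
    ((hfreq.and_eventually (eventually_ge_atTop 1)).mono fun n ⟨hr, hn⟩ => by
      have hn0 : (0 : ℝ) < n := by exact_mod_cast hn
      rw [lt_div_iff₀ hn0] at hr
      have hle := d.lo_le_hi n hn
      obtain ⟨k, hk, hkr⟩ : ∃ k ∈ Set.Icc (d.lo n) (d.hi n), d.ratio / 2 * n < |(k : ℝ)| := by
        rcases lt_max_iff.1 hr with h | h
        exacts [⟨_, ⟨hle, le_rfl⟩, h⟩, ⟨_, ⟨le_rfl, hle⟩, h⟩]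
      refine ⟨k, hk, ?_⟩
      rw [mul_right_comm]
      gcongr)).1
  have : 0 < d.ratio / 2 * mutualInfo P := by positivity
  linarith

end Asymptotics

end AsyncSW

theorem corollary2 {α β : Type*} [Fintype α] [Fintype β] (P : PMF (α × β))
    (d : AsyncSW.DelayBound) :
    AsyncSW.rateRegion {P} d ≠ AsyncSW.rateRegion {P} AsyncSW.DelayBound.zero ↔
      d.ratio ≠ 0 ∧ AsyncSW.mutualInfo P ≠ 0 := by
  open AsyncSW in
  rw [rateRegion_eq_slepianWolfRegion (.inl DelayBound.ratio_zero)]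
  constructor
  · intro h
    by_contra hcon
    exact h (rateRegion_eq_slepianWolfRegion (by tauto))
  · rintro ⟨hd, hI⟩ h
    -- The corner point `(H(X|Y), H(Y))` has sum rate exactly `H(X,Y)`.
    have hcorner : (agreeEntropy P True True - agreeEntropy P False True,
        agreeEntropy P False True) ∈ rateRegion {P} d := by
      rw [h]
      refine ⟨le_rfl, ?_, (sub_add_cancel _ _).ge⟩
      have := mutualInfo_nonneg P
      rw [mutualInfo_eq] at this
      simp only
      linarith
    have := entropy_lt_of_achievable hd hI hcorner
    simp only [sub_add_cancel, lt_irrefl] at this
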